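/- Let $\nabla$ be the category whose objects are the linearly ordered sets $\langle\!\langle n\rangle\!\rangle=\{-\infty,1,\dots,n,\infty\}$, $n\in\mathbb N$, and whose morphisms are the order-preserving maps that fix $-\infty$ and $\infty$. A *crossed interval group* is a presheaf of sets $G$ on $\nabla$, with $G_n:=G(\langle\!\langle n\rangle\!\rangle)$, together with a group structure on each $G_n$ and left actions of $G_n$ on the sets $\nabla(\langle\!\langle m\rangle\!\rangle,\langle\!\langle n\rangle\!\rangle)$, written $(x,\varphi)\mapsto\varphi^x$, such that $(\varphi\psi)^x=\varphi^x\psi^{\varphi^*(x)}$ and $\varphi^*(xy)=(\varphi^y)^*(x)\,\varphi^*(y)$. A map of crossed interval groups is a map of presheaves $f$ that is a group homomorphism in each degree and satisfies $\varphi^{f(x)}=\varphi^x$. A crossed interval subgroup is a subpresheaf that is a subgroup in each degree, with the restricted actions. Let $\mathfrak H$ be the hyperoctahedral crossed interval group. Here $\mathfrak H_n=\mathfrak S_n\ltimes(\mathbb Z/2\mathbb Z)^n$ with product $(\tau;\delta)(\sigma;\varepsilon)=(\tau\sigma;(\delta_{\sigma(i)}+\varepsilon_i)_i)$. Put $\sigma(\pm\infty)=\pm\infty$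 and $\varepsilon_{\pm\infty}=0$. For $\varphi:\langle\!\langle m\rangle\!\rangle\to\langle\!\langle n\rangle\!\rangle$, the morphism $\varphi^{(\sigma;\varepsilon)}$ is the one whose fibre over each $j$ has as many elements as $\varphi^{-1}\{\sigma^{-1}(j)\}$, and $\varphi^*(\sigma;\varepsilon)=(\tilde\sigma;(\varepsilon_{\varphi(i)})_i)$, where $\tilde\sigma$ is the permutation with $\varphi^{(\sigma;\varepsilon)}\tilde\sigma=\sigma\varphi$ that is order-preserving on $\varphi^{-1}\{j\}$ if $\varepsilon_j=0$ and order-reversing if $\varepsilon_j=1$. Let $\mathbf{CrsGrp}_\nabla^{/\mathfrak H}$ be the category of crossed interval groups over $\mathfrak H$. A morphism $\rho:\langle\!\langle n\rangle\!\rangle\to\langle\!\langle k\rangle\!\rangle$ in $\nabla$ is *inert* if it restricts to a bijection $\rho^{-1}\{1,\dots,k\}\to\{1,\dots,k\}$. Two morphisms $\rho_1,\rho_2$ with the same domain $\langle\!\langle n\rangle\!\rangle$ are *dissociated* if for every $\alpha:\langle\!\langle1\rangle\!\rangle\to\langle\!\langle n\rangle\!\rangle$ at least one of $\rho_1\alpha,\rho_2\alpha$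 factors through $\langle\!\langle0\rangle\!\rangle$. A crossed interval group $G$ is *operadic* if (i) $\rho^x=\rho$ for every inert $\rho:\langle\!\langle n\rangle\!\rangle\to\langle\!\langle k\rangle\!\rangle$ and every $x\in G_k$, and (ii) $\rho_1^*(x_1)$ and $\rho_2^*(x_2)$ commute in $G_n$ for all dissociated inert $\rho_i:\langle\!\langle n\rangle\!\rangle\to\langle\!\langle k_i\rangle\!\rangle$ and all $x_i\in G_{k_i}$, $i=1,2$. Let $\mathbf{CrsOpGrp}\subset\mathbf{CrsGrp}_\nabla^{/\mathfrak H}$ be the full subcategory of the operadic crossed interval groups. **Theorem.** The subcategory $\mathbf{CrsOpGrp}\subset\mathbf{CrsGrp}_\nabla^{/\mathfrak H}$ is reflective, i.e. the inclusion functor admits a left adjoint $G\mapsto\widetilde G$. Moreover, for $G$ over $\mathfrak H$ let $K(G)\subset G$ be the crossed interval subgroup generated by the commutators $[\rho_1^*(x_1),\rho_2^*(x_2)]\in G_n$, where $n$ is arbitrary, $\rho_i:\langle\!\langle n\rangle\!\rangle\to\langle\!\langle k_i\rangle\!\rangle$ ($i=1,2$) are dissociated inert morphisms and $x_i\in G_{k_i}$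 (that is, the smallest crossed interval subgroup that contains all of them). Then the map from $K(G)$ to the trivial crossed interval group $*$ is a map over $\mathfrak H$, and the left adjoint can be chosen so that its unit $G\to\widetilde G$ fits into a pushout square in $\mathbf{CrsGrp}_\nabla^{/\mathfrak H}$ $$\begin{array}{ccc}K(G)&\to&*\\ \downarrow&&\downarrow\\ G&\to&\widetilde G,\end{array}$$ and in each degree $G_n\to\widetilde G_n$ is the quotient of $G_n$ by the normal closure of $K(G)_n$. -/

import Mathlib

open CategoryTheory

/-! ### Crossed groups over a category -/

/-- A crossed `A`-group: a presheaf `a ↦ obj a`, `φ ↦ φ^*`, on `A` with a group structure on each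
`obj a` and a left action `φ ↦ φ^x` of `obj a` on each set of morphisms `b ⟶ a`, such that
`(φ ∘ ψ)^x = φ^x ∘ ψ^{φ^*(x)}` and `φ^*(x y) = (φ^y)^*(x) φ^*(y)`. -/
structure CrossedGroup.{w, v, u} (A : Type u) [Category.{v} A] where
  obj : A → Type w
  [group : ∀ a, Group (obj a)]
  /-- the restriction map `φ^*` of the presheaf -/
  map : ∀ {b a : A}, (b ⟶ a) → obj a → obj b
  map_id : ∀ {a : A} (x : obj a), map (𝟙 a) x = x
  map_comp : ∀ {c b a : A} (ψ : c ⟶ b) (φ : b ⟶ a) (x : obj a), map (ψ ≫ φ) x = map ψ (map φ x)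
  /-- the action `act x φ = φ^x` -/
  act : ∀ {b a : A}, obj a → (b ⟶ a) → (b ⟶ a)
  act_one : ∀ {b a : A} (φ : b ⟶ a), act 1 φ = φ
  act_mul : ∀ {b a : A} (x y : obj a) (φ : b ⟶ a), act (x * y) φ = act x (act y φ)
  act_comp : ∀ {c b a : A} (ψ : c ⟶ b) (φ : b ⟶ a) (x : obj a),
    act x (ψ ≫ φ) = act (map φ x) ψ ≫ act x φ
  map_mul : ∀ {b a : A} (φ : b ⟶ a) (x y : obj a), map φ (x * y) = map (act y φ) x * map φ y

namespace CrossedGroup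

universe w v u

variable {A : Type u} [Category.{v} A]

attribute [instance] CrossedGroup.group

/-- A map of crossed groups: a map of presheaves that is degreewise a group homomorphism and
respects the actions on the morphisms of `A`. -/
@[ext]
structure Hom (G H : CrossedGroup.{w} A) where
  app : ∀ a, G.obj a →* H.obj a
  naturality : ∀ {b a : A} (φ : b ⟶ a) (x : G.obj a), app b (G.map φ x) = H.map φ (app a x)
  act_app : ∀ {b a : A} (φ : b ⟶ a) (x : G.obj a), H.act (app a x) φ = G.act x φ

instance : Category (CrossedGroup.{w} A) where
  Hom := Hom
  id G := ⟨fun _ => MonoidHom.id _, fun _ _ => rfl, fun _ _ => rfl⟩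
  comp f g := ⟨fun a => (g.app a).comp (f.app a),
    fun φ x => by simp [f.naturality, g.naturality],
    fun φ x => by simp [f.act_app, g.act_app]⟩

lemma map_one (G : CrossedGroup.{w} A) {b a : A} (φ : b ⟶ a) : G.map φ 1 = 1 := by
  have h := G.map_mul φ 1 1
  rw [G.act_one, mul_one] at h
  exact (mul_eq_left (a := G.map φ 1)).1 h.symm

/-- The trivial crossed group. -/
def trivial (A : Type u) [Category.{v} A] : CrossedGroup.{w} A where
  obj _ := PUnit
  map _ x := x
  map_id _ := rfl
  map_comp _ _ _ := rfl
  act _ φ := φ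
  act_one _ := rfl
  act_mul _ _ _ := rfl
  act_comp _ _ _ := rfl
  map_mul _ _ _ := rfl

/-- The unique map from the trivial crossed group. -/
def fromTrivial (G : CrossedGroup.{w} A) : trivial.{w} A ⟶ G where
  app _ := 1
  naturality φ _ := (G.map_one φ).symm
  act_app φ _ := G.act_one φ

/-- A crossed subgroup of `G`: a subpresheaf that is degreewise a subgroup. -/
structure Sub (G : CrossedGroup.{w} A) where
  carrier : ∀ a, Subgroup (G.obj a)
  map_mem : ∀ {b a : A} (φ : b ⟶ a) {x : G.obj a}, x ∈ carrier a → G.map φ x ∈ carrier b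

/-- A crossed subgroup, as a crossed group with the structure inherited from `G`. -/
def Sub.toCrossedGroup {G : CrossedGroup.{w} A} (S : G.Sub) : CrossedGroup.{w} A where
  obj a := S.carrier a
  map φ x := ⟨G.map φ x.1, S.map_mem φ x.2⟩
  map_id x := Subtype.ext (G.map_id x.1)
  map_comp ψ φ x := Subtype.ext (G.map_comp ψ φ x.1)
  act x φ := G.act x.1 φ
  act_one φ := G.act_one φ
  act_mul x y φ := G.act_mul x.1 y.1 φ
  act_comp ψ φ x := G.act_comp ψ φ x.1
  map_mul φ x y := Subtype.ext (G.map_mul φ x.1 y.1)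

/-- The inclusion of a crossed subgroup. -/
def Sub.incl {G : CrossedGroup.{w} A} (S : G.Sub) : S.toCrossedGroup ⟶ G where
  app a := (S.carrier a).subtype
  naturality _ _ := rfl
  act_app _ _ := rfl

/-- The crossed subgroup generated by a family of subsets: the intersection of all crossed
subgroups that contain it. -/
def generated (G : CrossedGroup.{w} A) (s : ∀ a, Set (G.obj a)) : G.Sub where
  carrier a := ⨅ (S : G.Sub) (_ : ∀ c, s c ⊆ S.carrier c), S.carrier a
  map_mem φ x hx := by
    simp only [Subgroup.mem_iInf] at hx ⊢
    exact fun S hS => S.map_mem φ (hx S hS)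

end CrossedGroup

/-! ### The category of intervals -/

/-- Objects `⟪n⟫ = {-∞, 1, …, n, ∞}` of the category `∇` of intervals. -/
structure IntervalCat where
  len : ℕ

namespace IntervalCat

/-- The linearly ordered set `⟪n⟫`, with `-∞ = ⊥` and `∞ = ⊤`. -/
abbrev Pt (n : IntervalCat) : Type := Fin (n.len + 2)

/-- Morphisms of `∇`: order-preserving maps that preserve `-∞` and `∞`. -/
@[ext]
structure Hom (m n : IntervalCat) where
  toMap : BoundedOrderHom m.Pt n.Pt

instance : SmallCategory IntervalCat where
  Hom := Hom
  id n := ⟨BoundedOrderHom.id n.Pt⟩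
  comp f g := ⟨g.toMap.comp f.toMap⟩

lemma hom_ext {m n : IntervalCat} {φ ψ : m ⟶ n} (h : ∀ i, φ.toMap i = ψ.toMap i) : φ = ψ :=
  Hom.ext (DFunLike.ext _ _ h)

@[simp] lemma id_apply (n : IntervalCat) (i : n.Pt) : (𝟙 n : n ⟶ n).toMap i = i := rfl

@[simp] lemma comp_apply {k m n : IntervalCat} (ψ : k ⟶ m) (φ : m ⟶ n) (i : k.Pt) :
    (ψ ≫ φ).toMap i = φ.toMap (ψ.toMap i) := rfl

/-- The subset `{1, …, n}` of `⟪n⟫`. -/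
def inner (n : IntervalCat) : Set n.Pt := {i | i ≠ ⊥ ∧ i ≠ ⊤}

/-- `φ : ⟪m⟫ ⟶ ⟪n⟫` is inert if it restricts to a bijection `φ⁻¹{1, …, n} → {1, …, n}`. -/
def Inert {m n : IntervalCat} (φ : m ⟶ n) : Prop :=
  Set.BijOn φ.toMap (φ.toMap ⁻¹' n.inner) n.inner

/-- `φ` factors through the object `⟪0⟫`. -/
def FactorsThroughZero {m n : IntervalCat} (φ : m ⟶ n) : Prop :=
  ∃ (β : m ⟶ ⟨0⟩) (γ : (⟨0⟩ : IntervalCat) ⟶ n), φ = β ≫ γ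

/-- Two morphisms with the same domain `⟪n⟫` are dissociated if for each `α : ⟪1⟫ ⟶ ⟪n⟫` one of
their composites with `α` factors through `⟪0⟫`. -/
def Dissociated {n k₁ k₂ : IntervalCat} (φ₁ : n ⟶ k₁) (φ₂ : n ⟶ k₂) : Prop :=
  ∀ α : (⟨1⟩ : IntervalCat) ⟶ n, FactorsThroughZero (α ≫ φ₁) ∨ FactorsThroughZero (α ≫ φ₂)

end IntervalCat

/-- Crossed interval groups. -/
abbrev CrossedIntervalGroup.{w} := CrossedGroup.{w} IntervalCat

/-! ### The hyperoctahedral crossed interval group -/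

/-- The `n`-th hyperoctahedral group `𝔖_n ⋉ (ℤ/2)^n`. Its elements `(σ; ε)` consist of a permutation
`σ` of `{1, …, n}` and signs `ε_1, …, ε_n ∈ ℤ/2`; here both are extended to `⟪n⟫`, by
`σ(±∞) = ±∞` and `ε_{±∞} = 0`. -/
@[ext]
structure Hyperoct.{w} (n : IntervalCat) : Type w where
  perm : Equiv.Perm n.Pt
  sign : n.Pt → ZMod 2
  perm_bot : perm ⊥ = ⊥
  perm_top : perm ⊤ = ⊤
  sign_bot : sign ⊥ = 0
  sign_top : sign ⊤ = 0

namespace Hyperoct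

universe w

variable {k m n : IntervalCat}

lemma zmod_two_add_self (a : ZMod 2) : a + a = 0 := by
  revert a; decide

/-- The group structure `(τ; δ) (σ; ε) = (τ σ; i ↦ δ_{σ(i)} + ε_i)`. -/
instance : Group (Hyperoct.{w} n) where
  mul h g := ⟨h.perm * g.perm, fun i => h.sign (g.perm i) + g.sign i,
    by simp [g.perm_bot, h.perm_bot], by simp [g.perm_top, h.perm_top],
    by simp [g.perm_bot, h.sign_bot, g.sign_bot], by simp [g.perm_top, h.sign_top, g.sign_top]⟩
  one := ⟨1, fun _ => 0, rfl, rfl, rfl, rfl⟩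
  inv g := ⟨g.perm⁻¹, fun i => g.sign (g.perm⁻¹ i),
    by rw [Equiv.Perm.inv_eq_iff_eq, g.perm_bot], by rw [Equiv.Perm.inv_eq_iff_eq, g.perm_top],
    by rw [show g.perm⁻¹ ⊥ = ⊥ by rw [Equiv.Perm.inv_eq_iff_eq, g.perm_bot], g.sign_bot],
    by rw [show g.perm⁻¹ ⊤ = ⊤ by rw [Equiv.Perm.inv_eq_iff_eq, g.perm_top], g.sign_top]⟩
  mul_assoc a b c := Hyperoct.ext (mul_assoc _ _ _) (funext fun _ => add_assoc _ _ _)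
  one_mul a := Hyperoct.ext (one_mul _) (funext fun _ => zero_add _)
  mul_one a := Hyperoct.ext (mul_one _) (funext fun _ => add_zero _)
  inv_mul_cancel a := Hyperoct.ext (inv_mul_cancel _) (funext fun i => by
    change a.sign (a.perm⁻¹ (a.perm i)) + a.sign i = 0
    rw [show a.perm⁻¹ (a.perm i) = i from a.perm.symm_apply_apply i, zmod_two_add_self])

lemma mul_perm (h g : Hyperoct.{w} n) : (h * g).perm = h.perm * g.perm := rfl

lemma mul_sign (h g : Hyperoct.{w} n) (i : n.Pt) :
    (h * g).sign i = h.sign (g.perm i) + g.sign i := rfl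

lemma one_perm : (1 : Hyperoct.{w} n).perm = 1 := rfl

lemma one_sign (i : n.Pt) : (1 : Hyperoct.{w} n).sign i = 0 := rfl

/-- The map `i ↦ (σ(φ(i)), ±i)`, where `±` is the order reversal if `ε_{φ(i)} ≠ 0`. -/
def key (φ : m ⟶ n) (g : Hyperoct.{w} n) (i : m.Pt) : n.Pt ×ₗ m.Pt :=
  toLex (g.perm (φ.toMap i), if g.sign (φ.toMap i) = 0 then i else i.rev)

/-- The permutation `σ~` of `⟪m⟫` in `φ^*(σ; ε) = (σ~; ε ∘ φ)`. It sorts `⟪m⟫` by `key φ (σ; ε)`, that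
is, it moves the fibre `φ⁻¹{j}` to the place `σ(j)`, in an order-preserving way if `ε_j = 0` and
in an order-reversing way otherwise. -/
def pullPerm (φ : m ⟶ n) (g : Hyperoct.{w} n) : Equiv.Perm m.Pt := (Tuple.sort (key φ g))⁻¹

lemma key_lt_iff (φ : m ⟶ n) (g : Hyperoct.{w} n) (i j : m.Pt) :
    key φ g i < key φ g j ↔ g.perm (φ.toMap i) < g.perm (φ.toMap j) ∨
      φ.toMap i = φ.toMap j ∧ (g.sign (φ.toMap i) = 0 ∧ i < j ∨ g.sign (φ.toMap i) ≠ 0 ∧ j < i) := by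
  unfold key
  rw [Prod.Lex.toLex_lt_toLex]
  simp only [EmbeddingLike.apply_eq_iff_eq]
  refine or_congr_right (and_congr_right fun h => ?_)
  rw [← h]
  by_cases hs : g.sign (φ.toMap i) = 0 <;> simp [hs]

lemma key_injective (φ : m ⟶ n) (g : Hyperoct.{w} n) : Function.Injective (key φ g) := by
  intro i j h
  have h1 := (key_lt_iff φ g i j).not.1 (by simp [h])
  have h2 := (key_lt_iff φ g j i).not.1 (by simp [h])
  have h3 : φ.toMap i = φ.toMap j := by
    have := congrArg (fun x => (ofLex x).1) h
    simpa [key] using this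
  rw [h3] at h1 h2
  by_contra hij
  by_cases hs : g.sign (φ.toMap j) = 0 <;> rcases lt_or_gt_of_ne hij with hlt | hlt <;> simp_all

lemma strictMono_key_symm (φ : m ⟶ n) (g : Hyperoct.{w} n) :
    StrictMono (key φ g ∘ (pullPerm φ g).symm) := by
  have h : StrictMono (key φ g ∘ Tuple.sort (key φ g)) :=
    (Tuple.monotone_sort (key φ g)).strictMono_of_injective
      ((key_injective φ g).comp (Tuple.sort (key φ g)).injective)
  exact h

lemma pullPerm_lt_iff (φ : m ⟶ n) (g : Hyperoct.{w} n) (i j : m.Pt) :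
    pullPerm φ g i < pullPerm φ g j ↔ key φ g i < key φ g j := by
  have := (strictMono_key_symm φ g).lt_iff_lt (a := pullPerm φ g i) (b := pullPerm φ g j)
  simpa using this.symm

lemma pullPerm_unique (φ : m ⟶ n) (g : Hyperoct.{w} n) (τ : Equiv.Perm m.Pt)
    (h : ∀ i j, key φ g i < key φ g j → τ i < τ j) : τ = pullPerm φ g := by
  have hmono : StrictMono (τ ∘ (pullPerm φ g).symm) := fun a b hab =>
    h _ _ (strictMono_key_symm φ g hab)
  have hid : (τ ∘ (pullPerm φ g).symm) = id :=
    congrArg DFunLike.coe (Subsingleton.elim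
      (hmono.orderIsoOfSurjective _ (τ.surjective.comp (pullPerm φ g).symm.surjective))
      (OrderIso.refl _))
  ext1 i
  have := congrFun hid (pullPerm φ g i)
  simpa using this

lemma pullPerm_bot (φ : m ⟶ n) (g : Hyperoct.{w} n) : pullPerm φ g ⊥ = ⊥ := by
  by_contra h
  have h1 : pullPerm φ g ((pullPerm φ g).symm ⊥) < pullPerm φ g ⊥ := by
    simpa using bot_lt_iff_ne_bot.2 h
  have h2 := (key_lt_iff φ g _ _).1 ((pullPerm_lt_iff φ g _ _).1 h1)
  simp only [map_bot, g.perm_bot, not_lt_bot, false_or] at h2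
  obtain ⟨h3, h4⟩ := h2
  rw [h3] at h4
  simp [g.sign_bot] at h4

lemma pullPerm_top (φ : m ⟶ n) (g : Hyperoct.{w} n) : pullPerm φ g ⊤ = ⊤ := by
  by_contra h
  have h1 : pullPerm φ g ⊤ < pullPerm φ g ((pullPerm φ g).symm ⊤) := by
    simpa using lt_top_iff_ne_top.2 h
  have h2 := (key_lt_iff φ g _ _).1 ((pullPerm_lt_iff φ g _ _).1 h1)
  simp only [map_top, g.perm_top, not_top_lt, false_or] at h2
  simp [g.sign_top] at h2

/-- The restriction map `φ^*(σ; ε) = (σ~; ε ∘ φ)`. -/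
def pull (φ : m ⟶ n) (g : Hyperoct.{w} n) : Hyperoct.{w} m where
  perm := pullPerm φ g
  sign i := g.sign (φ.toMap i)
  perm_bot := pullPerm_bot φ g
  perm_top := pullPerm_top φ g
  sign_bot := by simp [g.sign_bot]
  sign_top := by simp [g.sign_top]

/-- The action `φ^(σ; ε)` of `(σ; ε)` on a morphism `φ`: the unique order-preserving map whose fibre
over `j` has as many elements as the fibre of `φ` over `σ⁻¹(j)`, which is `σ ∘ φ ∘ σ~⁻¹`. -/
def act (g : Hyperoct.{w} n) (φ : m ⟶ n) : m ⟶ n where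
  toMap :=
    { toFun := fun i => g.perm (φ.toMap ((pullPerm φ g).symm i))
      monotone' := fun i j hij => by
        have h := (strictMono_key_symm φ g).monotone hij
        exact Prod.Lex.monotone_fst _ _ h
      map_bot' := by
        rw [(Equiv.symm_apply_eq _).2 (pullPerm_bot φ g).symm, map_bot, g.perm_bot]
      map_top' := by
        rw [(Equiv.symm_apply_eq _).2 (pullPerm_top φ g).symm, map_top, g.perm_top] }

lemma act_apply (g : Hyperoct.{w} n) (φ : m ⟶ n) (i : m.Pt) :
    (act g φ).toMap i = g.perm (φ.toMap ((pullPerm φ g).symm i)) := rfl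

lemma act_apply_pullPerm (g : Hyperoct.{w} n) (φ : m ⟶ n) (i : m.Pt) :
    (act g φ).toMap (pullPerm φ g i) = g.perm (φ.toMap i) := by
  rw [act_apply, Equiv.symm_apply_apply]

lemma pullPerm_one (φ : m ⟶ n) : pullPerm φ (1 : Hyperoct.{w} n) = 1 := by
  refine (pullPerm_unique φ 1 1 fun i j h => ?_).symm
  rw [key_lt_iff] at h
  simp only [one_perm, one_sign, Equiv.Perm.one_apply] at h ⊢
  rcases h with h | h
  · exact φ.toMap.monotone'.reflect_lt h
  · simpa using h.2

lemma pullPerm_id (g : Hyperoct.{w} n) : pullPerm (𝟙 n) g = g.perm := by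
  refine (pullPerm_unique (𝟙 n) g g.perm fun i j h => ?_).symm
  rw [key_lt_iff] at h
  rcases h with h | ⟨rfl, h⟩
  · exact h
  · simp at h

lemma pullPerm_comp (ψ : k ⟶ m) (φ : m ⟶ n) (g : Hyperoct.{w} n) :
    pullPerm (ψ ≫ φ) g = pullPerm ψ (pull φ g) := by
  refine (pullPerm_unique (ψ ≫ φ) g _ fun i j h => ?_).symm
  rw [pullPerm_lt_iff, key_lt_iff]
  rw [key_lt_iff] at h
  simp only [pull, pullPerm_lt_iff, key_lt_iff, IntervalCat.comp_apply] at h ⊢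
  rcases h with h | ⟨h, ⟨hs, hij⟩ | ⟨hs, hij⟩⟩
  · exact Or.inl (Or.inl h)
  · rcases (ψ.toMap.monotone' hij.le).lt_or_eq with h' | h'
    · exact Or.inl (Or.inr ⟨h, Or.inl ⟨hs, h'⟩⟩)
    · exact Or.inr ⟨h', Or.inl ⟨hs, hij⟩⟩
  · rcases (ψ.toMap.monotone' hij.le).lt_or_eq with h' | h'
    · exact Or.inl (Or.inr ⟨h, Or.inr ⟨hs, h'⟩⟩)
    · exact Or.inr ⟨h'.symm, Or.inr ⟨hs, hij⟩⟩

lemma pullPerm_mul (φ : m ⟶ n) (h g : Hyperoct.{w} n) :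
    pullPerm φ (h * g) = pullPerm (act g φ) h * pullPerm φ g := by
  refine (pullPerm_unique φ (h * g) _ fun i j hlt => ?_).symm
  rw [Equiv.Perm.mul_apply, Equiv.Perm.mul_apply, pullPerm_lt_iff, key_lt_iff]
  rw [key_lt_iff] at hlt
  simp only [act_apply_pullPerm, pullPerm_lt_iff, key_lt_iff, mul_perm, mul_sign,
    Equiv.Perm.mul_apply] at hlt ⊢
  rcases hlt with hlt | ⟨he, hlt⟩
  · exact Or.inl hlt
  · refine Or.inr ⟨by rw [he], ?_⟩
    rw [← he]
    have key : ∀ a b : ZMod 2, (a + b = 0 ↔ (a = 0 ↔ b = 0)) := by decide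
    simp only [ne_eq, key, lt_irrefl, true_and, false_or] at hlt ⊢
    tauto

end Hyperoct

/-- The hyperoctahedral crossed interval group `𝔥`. -/
def hyperoctahedral.{w} : CrossedIntervalGroup.{w} where
  obj n := Hyperoct.{w} n
  map φ g := Hyperoct.pull φ g
  map_id g := Hyperoct.ext (Hyperoct.pullPerm_id g) rfl
  map_comp ψ φ g := Hyperoct.ext (Hyperoct.pullPerm_comp ψ φ g) rfl
  act g φ := Hyperoct.act g φ
  act_one φ := IntervalCat.hom_ext fun i => by
    rw [Hyperoct.act_apply, Hyperoct.pullPerm_one]; rfl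
  act_mul h g φ := IntervalCat.hom_ext fun i => by
    rw [Hyperoct.act_apply, Hyperoct.act_apply, Hyperoct.act_apply, Hyperoct.pullPerm_mul]; rfl
  act_comp ψ φ g := IntervalCat.hom_ext fun i => by
    rw [IntervalCat.comp_apply, Hyperoct.act_apply, Hyperoct.act_apply, Hyperoct.act_apply,
      Hyperoct.pullPerm_comp]
    change _ = g.perm (φ.toMap ((Hyperoct.pullPerm φ g).symm (Hyperoct.pullPerm φ g _)))
    rw [Equiv.symm_apply_apply]; rfl
  map_mul φ h g := Hyperoct.ext (Hyperoct.pullPerm_mul φ h g) (funext fun i => by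
    change _ = h.sign ((Hyperoct.act g φ).toMap (Hyperoct.pullPerm φ g i)) + g.sign (φ.toMap i)
    rw [Hyperoct.act_apply_pullPerm]; rfl)

/-! ### Operadic crossed interval groups -/

namespace CrossedIntervalGroup

universe w

/-- A crossed interval group `G` is operadic if inert morphisms are fixed by the actions of `G`, and
for dissociated inert morphisms `ρ₁`, `ρ₂` the elements of the images of `ρ₁^*` and `ρ₂^*`
commute. -/
def IsOperadic (G : CrossedIntervalGroup.{w}) : Prop :=
  (∀ {n k : IntervalCat} (ρ : n ⟶ k), IntervalCat.Inert ρ → ∀ x : G.obj k, G.act x ρ = ρ) ∧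
  ∀ {n k₁ k₂ : IntervalCat} (ρ₁ : n ⟶ k₁) (ρ₂ : n ⟶ k₂),
    IntervalCat.Inert ρ₁ → IntervalCat.Inert ρ₂ → IntervalCat.Dissociated ρ₁ ρ₂ →
      ∀ (x₁ : G.obj k₁) (x₂ : G.obj k₂), Commute (G.map ρ₁ x₁) (G.map ρ₂ x₂)

/-- The commutators `[ρ₁^*(x₁), ρ₂^*(x₂)]` in `G_n` for dissociated inert `ρ₁`, `ρ₂`. -/
def operadicCommutators (G : CrossedIntervalGroup.{w}) (n : IntervalCat) : Set (G.obj n) :=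
  {x | ∃ (k₁ k₂ : IntervalCat) (ρ₁ : n ⟶ k₁) (ρ₂ : n ⟶ k₂) (x₁ : G.obj k₁) (x₂ : G.obj k₂),
    IntervalCat.Inert ρ₁ ∧ IntervalCat.Inert ρ₂ ∧ IntervalCat.Dissociated ρ₁ ρ₂ ∧
      x = G.map ρ₁ x₁ * G.map ρ₂ x₂ * (G.map ρ₁ x₁)⁻¹ * (G.map ρ₂ x₂)⁻¹}

/-- The crossed interval subgroup `K(G)` of `G` generated by these commutators. -/
def operadicKernel (G : CrossedIntervalGroup.{w}) : G.Sub :=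
  G.generated G.operadicCommutators

end CrossedIntervalGroup

/-- The operadic objects of the category `CrsGrp_∇^{/𝔥}` of crossed interval groups over `𝔥`. -/
def isOperadicOver.{w} : ObjectProperty (Over hyperoctahedral.{w}) :=
  fun G => G.left.IsOperadic

/-- The full subcategory `CrsOpGrp` of operadic crossed interval groups over `𝔥`. -/
abbrev CrsOpGrp.{w} := isOperadicOver.{w}.FullSubcategory

/-- `K(G)` as an object over `𝔥`. -/
def operadicKernelOver.{w} (G : Over hyperoctahedral.{w}) : Over hyperoctahedral.{w} :=
  Over.mk (G.left.operadicKernel.incl ≫ G.hom)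

/-- The inclusion of `K(G)` in `G`, over `𝔥`. -/
def operadicKernelIncl.{w} (G : Over hyperoctahedral.{w}) : operadicKernelOver G ⟶ G :=
  Over.homMk G.left.operadicKernel.incl

/-- The trivial crossed interval group `*` over `𝔥`. -/
def trivialOver.{w} : Over hyperoctahedral.{w} :=
  Over.mk (CrossedGroup.fromTrivial hyperoctahedral)

/-- The unique map `* ⟶ G` over `𝔥`. -/
def fromTrivialOver.{w} (G : Over hyperoctahedral.{w}) : trivialOver.{w} ⟶ G :=
  Over.homMk (CrossedGroup.fromTrivial G.left)
    (CrossedGroup.Hom.ext (funext fun a => MonoidHom.ext fun _ => (G.hom.app a).map_one))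

universe w

/-! A map to $\mathfrak H$ controls the action: $x\in G_n$ acts on morphisms as its image in
$\mathfrak H_n$ does. Since $\varphi^*(\sigma;\varepsilon)$ fixes the points that $\varphi$ sends to
$\pm\infty$, inert morphisms are fixed by $\mathfrak H$, and elements restricted along dissociated
morphisms have disjoint supports and commute. So condition (i) is automatic over $\mathfrak H$
(`Hyperoct.act_of_inert`), and $K(G)$ lies in the kernel of $G\to\mathfrak H$
(`Hyperoct.commute_pull_of_dissociated`), hence acts trivially.

Trivial action is what makes the quotient exist: $\varphi^*$ is only a crossed homomorphism, but it
is multiplicative on elements that fix $\varphi$, and it takes conjugates of such elements to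
conjugates (`map_conj`). Hence the degreewise normal closure of $K(G)$ is a crossed subgroup, and
the structure of $G$ descends to the quotient. Kernels are crossed subgroups, so a map to an
operadic object, which kills the commutators, kills $K(G)$ and factors uniquely. The pushout
property is the same factorization. -/

namespace CrossedGroup

/-! ### Quotients by crossed subgroups that act trivially -/

section Quotient

universe v u

variable {A : Type u} [Category.{v} A] {G H P : CrossedGroup.{w} A}

@[simp] lemma comp_app (f : G ⟶ H) (g : H ⟶ P) (a : A) (x : G.obj a) :
    Hom.app (f ≫ g) a x = Hom.app g a (Hom.app f a x) := rfl

lemma hom_ext {f g : G ⟶ H} (h : ∀ a x, Hom.app f a x = Hom.app g a x) : f = g :=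
  Hom.ext (funext fun a => MonoidHom.ext (h a))

lemma map_inv (G : CrossedGroup.{w} A) {b a : A} (φ : b ⟶ a) (x : G.obj a) :
    G.map φ x⁻¹ = (G.map (G.act x⁻¹ φ) x)⁻¹ := by
  rw [eq_inv_iff_mul_eq_one, mul_eq_one_comm, ← G.map_mul, mul_inv_cancel, G.map_one]

/-- The kernel of a map of crossed groups. -/
def ker (f : G ⟶ H) : G.Sub where
  carrier a := (Hom.app f a).ker
  map_mem φ x hx := by
    rw [MonoidHom.mem_ker] at hx ⊢
    rw [Hom.naturality, hx, H.map_one]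

lemma act_of_mem_ker (f : G ⟶ H) {b a : A} {x : G.obj a} (hx : x ∈ (ker f).carrier a)
    (φ : b ⟶ a) : G.act x φ = φ := by
  have hx' : Hom.app f a x = 1 := hx
  rw [← Hom.act_app f, hx', H.act_one]

/-- A crossed subgroup whose elements act trivially on the morphisms of `A`. -/
def Sub.ActsTrivially (S : G.Sub) : Prop :=
  ∀ {b a : A} {x : G.obj a}, x ∈ S.carrier a → ∀ φ : b ⟶ a, G.act x φ = φ

/-- Expanding the product restricts $g$ along $\varphi^{xg^{-1}}$, whereas inverting
$\varphi^*(g^{-1})$ gives the restriction of $g$ along $\varphi^{g^{-1}}$. The hypothesis makes the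
two agree, so a conjugate remains a conjugate. -/
lemma map_conj (G : CrossedGroup.{w} A) {b a : A} (φ : b ⟶ a) (g x : G.obj a)
    (hx : G.act x (G.act g⁻¹ φ) = G.act g⁻¹ φ) :
    G.map φ (g * x * g⁻¹) =
      G.map (G.act g⁻¹ φ) g * G.map (G.act g⁻¹ φ) x * (G.map (G.act g⁻¹ φ) g)⁻¹ := by
  rw [G.map_mul, G.map_mul, hx, map_inv]

lemma map_mul_of_act_eq (G : CrossedGroup.{w} A) {b a : A} (φ : b ⟶ a) (x y : G.obj a)
    (hy : G.act y φ = φ) : G.map φ (x * y) = G.map φ x * G.map φ y := by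
  rw [G.map_mul, hy]

/-- The elements that fix all morphisms into an object form the kernel of a group action, hence a
normal subgroup. -/
lemma act_eq_of_mem_normalClosure {S : G.Sub} (hS : S.ActsTrivially) {b a : A} {x : G.obj a}
    (hx : x ∈ Subgroup.normalClosure (S.carrier a : Set (G.obj a))) (φ : b ⟶ a) :
    G.act x φ = φ := by
  induction hx using Subgroup.closure_induction generalizing φ with
  | mem x hx =>
    obtain ⟨s, hs, hsx⟩ := Group.mem_conjugatesOfSet_iff.1 hx
    obtain ⟨g, rfl⟩ := isConj_iff.1 hsx
    rw [G.act_mul, G.act_mul, hS hs, ← G.act_mul, mul_inv_cancel, G.act_one]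
  | one => exact G.act_one φ
  | mul x y _ _ hx hy => rw [G.act_mul, hy, hx]
  | inv x _ hx => conv_lhs => rw [← hx φ, ← G.act_mul, inv_mul_cancel, G.act_one]

/-- The degreewise normal closure of a crossed subgroup that acts trivially. -/
def Sub.normalClosure (S : G.Sub) (hS : S.ActsTrivially) : G.Sub where
  carrier a := Subgroup.normalClosure (S.carrier a : Set (G.obj a))
  map_mem {b a} φ {x} hx := by
    have hact {b a : A} {x : G.obj a}
        (hx : x ∈ Subgroup.normalClosure (S.carrier a : Set (G.obj a))) (φ : b ⟶ a) :=
      act_eq_of_mem_normalClosure hS hx φ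
    induction hx using Subgroup.closure_induction generalizing φ with
    | mem x hx =>
      obtain ⟨s, hs, hsx⟩ := Group.mem_conjugatesOfSet_iff.1 hx
      obtain ⟨g, rfl⟩ := isConj_iff.1 hsx
      rw [G.map_conj φ g s (hS hs _)]
      exact Subgroup.normalClosure_normal.conj_mem _
        (Subgroup.subset_normalClosure (S.map_mem _ hs)) _
    | one => rw [G.map_one]; exact one_mem _
    | mul x y _ hy hx' hy' =>
      rw [G.map_mul_of_act_eq φ x y (hact hy φ)]
      exact mul_mem (hx' φ) (hy' φ)
    -- The restriction of $x^{-1}$ along $\varphi$ is the inverse of that of $x$ along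
    -- $\varphi^{x^{-1}}$, so the induction hypothesis is needed for all morphisms.
    | inv x hx hx' =>
      rw [map_inv]
      exact inv_mem (hx' _)

lemma Sub.normalClosure_actsTrivially (S : G.Sub) (hS : S.ActsTrivially) :
    (S.normalClosure hS).ActsTrivially :=
  fun hx φ => act_eq_of_mem_normalClosure hS hx φ

instance (S : G.Sub) (hS : S.ActsTrivially) (a : A) : ((S.normalClosure hS).carrier a).Normal :=
  Subgroup.normalClosure_normal

lemma exists_mul_of_mk_eq {a : A} {N : Subgroup (G.obj a)} {x y : G.obj a}
    (h : QuotientGroup.leftRel N x y) : ∃ n ∈ N, y = x * n :=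
  ⟨x⁻¹ * y, QuotientGroup.leftRel_apply.1 h, by group⟩

/-- The quotient of a crossed group by a normal crossed subgroup that acts trivially. -/
def quotient (N : G.Sub) [∀ a, (N.carrier a).Normal] (hN : N.ActsTrivially) :
    CrossedGroup.{w} A where
  obj a := G.obj a ⧸ N.carrier a
  map φ := Quotient.map' (G.map φ) fun x y h => by
    obtain ⟨n, hn, rfl⟩ := exists_mul_of_mk_eq h
    -- With the factor $n$ on the right, the twist is by $\varphi^n=\varphi$ and disappears.
    rw [G.map_mul_of_act_eq φ x n (hN hn φ), QuotientGroup.leftRel_apply, inv_mul_cancel_left]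
    exact N.map_mem φ hn
  map_id x := by
    induction x using QuotientGroup.induction_on with
    | H x => exact congrArg QuotientGroup.mk (G.map_id x)
  map_comp ψ φ x := by
    induction x using QuotientGroup.induction_on with
    | H x => exact congrArg QuotientGroup.mk (G.map_comp ψ φ x)
  act x φ := Quotient.liftOn' x (fun x => G.act x φ) fun x y h => by
    obtain ⟨n, hn, rfl⟩ := exists_mul_of_mk_eq h
    rw [G.act_mul, hN hn]
  act_one φ := G.act_one φ
  act_mul x y φ := by
    induction x using QuotientGroup.induction_on with
    | H x =>
      induction y using QuotientGroup.induction_on with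
      | H y => exact G.act_mul x y φ
  act_comp ψ φ x := by
    induction x using QuotientGroup.induction_on with
    | H x => exact G.act_comp ψ φ x
  map_mul φ x y := by
    induction x using QuotientGroup.induction_on with
    | H x =>
      induction y using QuotientGroup.induction_on with
      | H y => exact congrArg QuotientGroup.mk (G.map_mul φ x y)

section

variable (N : G.Sub) [∀ a, (N.carrier a).Normal] (hN : N.ActsTrivially)

/-- The projection onto a quotient. -/
def quotientMk : G ⟶ quotient N hN where
  app a := QuotientGroup.mk' (N.carrier a)
  naturality _ _ := rfl
  act_app _ _ := rfl

lemma quotientMk_surjective (a : A) : Function.Surjective (Hom.app (quotientMk N hN) a) :=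
  QuotientGroup.mk'_surjective _

lemma ker_quotientMk (a : A) : (Hom.app (quotientMk N hN) a).ker = N.carrier a :=
  QuotientGroup.ker_mk' _

/-- A map that is trivial on `N` factors through the quotient by `N`. -/
def quotientLift (f : G ⟶ P) (hf : ∀ a, N.carrier a ≤ (Hom.app f a).ker) :
    quotient N hN ⟶ P where
  app a := QuotientGroup.lift (N.carrier a) (Hom.app f a) (hf a)
  naturality φ x := by
    induction x using QuotientGroup.induction_on with
    | H x => exact Hom.naturality f φ x
  act_app φ x := by
    induction x using QuotientGroup.induction_on with
    | H x => exact Hom.act_app f φ x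

lemma quotientMk_lift (f : G ⟶ P) (hf : ∀ a, N.carrier a ≤ (Hom.app f a).ker) :
    quotientMk N hN ≫ quotientLift N hN f hf = f :=
  hom_ext fun _ _ => rfl

lemma quotient_hom_ext {f g : quotient N hN ⟶ P}
    (h : quotientMk N hN ≫ f = quotientMk N hN ≫ g) : f = g :=
  hom_ext fun a x => by
    obtain ⟨y, rfl⟩ := quotientMk_surjective N hN a x
    simpa using congrArg (fun k => Hom.app k a y) h

end

lemma trivial_hom_ext (f g : trivial.{w} A ⟶ G) : f = g :=
  hom_ext fun a x => by
    rw [show x = 1 from rfl, _root_.map_one, _root_.map_one]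

lemma generated_le {s : ∀ a, Set (G.obj a)} (S : G.Sub) (hS : ∀ a, s a ⊆ S.carrier a) (a : A) :
    (G.generated s).carrier a ≤ S.carrier a :=
  iInf₂_le S hS

lemma subset_generated (s : ∀ a, Set (G.obj a)) (a : A) :
    s a ⊆ (G.generated s).carrier a := fun x hx => by
  simp only [generated, SetLike.mem_coe, Subgroup.mem_iInf]
  exact fun S hS => hS a hx

end Quotient

end CrossedGroup

/-! ### Dissociated morphisms, pointwise -/

namespace IntervalCat

variable {m n k k₁ k₂ : IntervalCat}

/-- The morphism `⟪1⟫ ⟶ ⟪n⟫` with the value `i` at `1`. -/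
noncomputable def point (i : n.Pt) : (⟨1⟩ : IntervalCat) ⟶ n where
  toMap :=
    { toFun := ![⊥, i, ⊤]
      monotone' := Fin.monotone_iff_le_succ.2 fun j => by
        fin_cases j
        · exact bot_le
        · exact le_top
      map_bot' := rfl
      map_top' := rfl }

lemma FactorsThroughZero.eq_bot_or_eq_top {φ : m ⟶ n} (h : FactorsThroughZero φ) (i : m.Pt) :
    φ.toMap i = ⊥ ∨ φ.toMap i = ⊤ := by
  obtain ⟨β, γ, rfl⟩ := h
  rw [comp_apply]
  have h2 : ∀ j : (⟨0⟩ : IntervalCat).Pt, j = ⊥ ∨ j = ⊤ := by decide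
  rcases h2 (β.toMap i) with h | h
  · exact Or.inl (by rw [h, map_bot])
  · exact Or.inr (by rw [h, map_top])

/-- Test dissociation on the morphism from $\langle\!\langle1\rangle\!\rangle$ that hits $i$; `(1 :
Fin 3)` is the inner point of $\langle\!\langle1\rangle\!\rangle$. -/
lemma Dissociated.eq_bot_or_eq_top {ρ₁ : n ⟶ k₁} {ρ₂ : n ⟶ k₂} (h : Dissociated ρ₁ ρ₂)
    (i : n.Pt) : (ρ₁.toMap i = ⊥ ∨ ρ₁.toMap i = ⊤) ∨ (ρ₂.toMap i = ⊥ ∨ ρ₂.toMap i = ⊤) :=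
  (h (point i)).imp (fun h => h.eq_bot_or_eq_top (1 : Fin 3))
    (fun h => h.eq_bot_or_eq_top (1 : Fin 3))

end IntervalCat

/-! ### Inert and dissociated morphisms in the hyperoctahedral group -/

namespace Hyperoct

variable {m n : IntervalCat}

lemma sign_eq_zero_of_extreme (g : Hyperoct.{w} n) {j : n.Pt} (hj : j = ⊥ ∨ j = ⊤) :
    g.sign j = 0 := by
  rcases hj with rfl | rfl
  · exact g.sign_bot
  · exact g.sign_top

lemma perm_lt_perm_of_extreme (g : Hyperoct.{w} n) {j l : n.Pt} (hj : j = ⊥ ∨ j = ⊤) :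
    (g.perm l < g.perm j ↔ l < j) ∧ (g.perm j < g.perm l ↔ j < l) := by
  rcases hj with rfl | rfl
  · rw [g.perm_bot]
    simp only [not_lt_bot, bot_lt_iff_ne_bot, true_and]
    rw [not_iff_not]
    nth_rewrite 1 [← g.perm_bot]
    exact g.perm.injective.eq_iff
  · rw [g.perm_top]
    simp only [not_top_lt, lt_top_iff_ne_top, and_true]
    rw [not_iff_not]
    nth_rewrite 1 [← g.perm_top]
    exact g.perm.injective.eq_iff

/-- `φ^*(σ; ε)` fixes the points that `φ` sends to `±∞`. -/
lemma pullPerm_of_extreme (φ : m ⟶ n) (g : Hyperoct.{w} n) {i : m.Pt}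
    (hi : φ.toMap i = ⊥ ∨ φ.toMap i = ⊤) : pullPerm φ g i = i := by
  -- Comparisons with $i$ survive: $\sigma$ fixes the endpoint $\varphi(i)$, and its fibre is not
  -- reversed because the sign there is $0$.
  have hlt : ∀ j, pullPerm φ g j < pullPerm φ g i ↔ j < i := fun j => by
    rw [pullPerm_lt_iff, key_lt_iff, (g.perm_lt_perm_of_extreme hi).1]
    constructor
    · rintro (h | ⟨h, h' | h'⟩)
      · exact φ.toMap.monotone'.reflect_lt h
      · exact h'.2
      · exact absurd (h ▸ g.sign_eq_zero_of_extreme hi) h'.1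
    · intro h
      rcases (φ.toMap.monotone' h.le).lt_or_eq with h' | h'
      · exact Or.inl h'
      · exact Or.inr ⟨h', Or.inl ⟨(congrArg g.sign h').trans (g.sign_eq_zero_of_extreme hi), h⟩⟩
  -- A point of a finite chain is determined by the number of points below it.
  have hcard : (Finset.Iio (pullPerm φ g i)).card = (Finset.Iio i).card := by
    rw [← Finset.card_map (pullPerm φ g).toEmbedding (s := Finset.Iio i)]
    congr 1
    ext j
    simp only [Finset.mem_Iio, Finset.mem_map_equiv, ← hlt, Equiv.apply_symm_apply]
  simpa [Fin.ext_iff] using hcard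

/-- `φ^*(σ; ε)` preserves the set of points that `φ` does not send to `±∞`. -/
lemma pullPerm_extreme_iff (φ : m ⟶ n) (g : Hyperoct.{w} n) (i : m.Pt) :
    (φ.toMap (pullPerm φ g i) = ⊥ ∨ φ.toMap (pullPerm φ g i) = ⊤) ↔
      (φ.toMap i = ⊥ ∨ φ.toMap i = ⊤) := by
  constructor
  · intro h
    -- The image of $i$ is itself a fixed point, so by injectivity it equals $i$.
    have h1 := (pullPerm φ g).injective (pullPerm_of_extreme φ g h)
    rwa [h1] at h
  · intro h
    rwa [pullPerm_of_extreme φ g h]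

/-- Two monotone bijections between subsets of well-orders agree. -/
lemma eqOn_of_bijOn {α β : Type*} [LinearOrder α] [LinearOrder β] [WellFoundedLT β]
    {s : Set α} {t : Set β} {f g : α → β} (hf : Set.BijOn f s t) (hg : Set.BijOn g s t)
    (hf' : MonotoneOn f s) (hg' : MonotoneOn g s) : Set.EqOn f g s := by
  have key : ∀ {h : α → β} (hh : Set.BijOn h s t), MonotoneOn h s →
      StrictMono hh.mapsTo.restrict := fun hh hm =>
    Monotone.strictMono_of_injective (fun a b hab => hm a.2 b.2 hab)
      (hh.mapsTo.restrict_inj.2 hh.injOn)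
  intro i hi
  have h := congrArg (fun e : s ≃o t => (e ⟨i, hi⟩ : β)) (Subsingleton.elim
    ((key hf hf').orderIsoOfSurjective _ (hf.mapsTo.restrict_surjective_iff.2 hf.surjOn))
    ((key hg hg').orderIsoOfSurjective _ (hg.mapsTo.restrict_surjective_iff.2 hg.surjOn)))
  exact h

/-- The maps `φ^(σ; ε)` and `φ` agree if `φ` is inert. -/
lemma act_of_inert {φ : m ⟶ n} (hφ : IntervalCat.Inert φ) (g : Hyperoct.{w} n) :
    act g φ = φ := by
  have hS : ∀ i, i ∈ φ.toMap ⁻¹' n.inner ↔ ¬(φ.toMap i = ⊥ ∨ φ.toMap i = ⊤) := fun i => by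
    rw [not_or]; rfl
  have hpS : ∀ i, pullPerm φ g i ∈ φ.toMap ⁻¹' n.inner ↔ i ∈ φ.toMap ⁻¹' n.inner := fun i => by
    rw [hS, hS, pullPerm_extreme_iff]
  have hgS : ∀ j, g.perm j ∈ n.inner ↔ j ∈ n.inner := fun j => by
    have h₁ : g.perm j = ⊥ ↔ j = ⊥ := by
      nth_rewrite 1 [← g.perm_bot]
      exact g.perm.injective.eq_iff
    have h₂ : g.perm j = ⊤ ↔ j = ⊤ := by
      nth_rewrite 1 [← g.perm_top]
      exact g.perm.injective.eq_iff
    exact and_congr h₁.not h₂.not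
  -- As $\tilde\sigma$ and $\sigma$ preserve the inner points in question, $\varphi^g$ is a monotone
  -- bijection between the same two sets as $\varphi$, and there is only one such bijection.
  have hact : Set.BijOn (act g φ).toMap (φ.toMap ⁻¹' n.inner) n.inner := by
    refine ⟨fun i hi => ?_, fun i hi j hj hij => ?_, fun j hj => ?_⟩
    · obtain ⟨i, rfl⟩ := (pullPerm φ g).surjective i
      rw [act_apply_pullPerm, hgS]
      exact (hpS i).1 hi
    · obtain ⟨i, rfl⟩ := (pullPerm φ g).surjective i
      obtain ⟨j, rfl⟩ := (pullPerm φ g).surjective j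
      rw [act_apply_pullPerm, act_apply_pullPerm] at hij
      rw [hφ.injOn ((hpS i).1 hi) ((hpS j).1 hj) (g.perm.injective hij)]
    · obtain ⟨j, rfl⟩ := g.perm.surjective j
      obtain ⟨i, hi, rfl⟩ := hφ.surjOn ((hgS j).1 hj)
      exact ⟨pullPerm φ g i, (hpS i).2 hi, act_apply_pullPerm g φ i⟩
  refine IntervalCat.hom_ext fun i => ?_
  by_cases hi : i ∈ φ.toMap ⁻¹' n.inner
  · exact eqOn_of_bijOn hact hφ ((act g φ).toMap.monotone'.monotoneOn _)
      (φ.toMap.monotone'.monotoneOn _) hi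
  · have hi' : φ.toMap i = ⊥ ∨ φ.toMap i = ⊤ := not_not.1 ((hS i).not.1 hi)
    have h := act_apply_pullPerm g φ i
    rw [pullPerm_of_extreme φ g hi'] at h
    rw [h]
    rcases hi' with hi' | hi' <;> rw [hi']
    · exact g.perm_bot
    · exact g.perm_top

/-- Each point goes to $\pm\infty$ under one of the two morphisms and is then fixed by the
corresponding permutation, with sign $0$. So the permutations are disjoint, and neither one changes
the signs of the other factor. -/
lemma commute_pull_of_dissociated {n k₁ k₂ : IntervalCat} {φ₁ : n ⟶ k₁} {φ₂ : n ⟶ k₂}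
    (h : IntervalCat.Dissociated φ₁ φ₂) (g₁ : Hyperoct.{w} k₁) (g₂ : Hyperoct.{w} k₂) :
    Commute (pull φ₁ g₁) (pull φ₂ g₂) := by
  have hd : Equiv.Perm.Disjoint (pullPerm φ₁ g₁) (pullPerm φ₂ g₂) := fun i =>
    (h.eq_bot_or_eq_top i).imp (pullPerm_of_extreme φ₁ g₁) (pullPerm_of_extreme φ₂ g₂)
  refine Hyperoct.ext hd.commute (funext fun i => ?_)
  change g₁.sign (φ₁.toMap (pullPerm φ₂ g₂ i)) + g₂.sign (φ₂.toMap i) =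
    g₂.sign (φ₂.toMap (pullPerm φ₁ g₁ i)) + g₁.sign (φ₁.toMap i)
  rcases h.eq_bot_or_eq_top i with hi | hi
  · rw [pullPerm_of_extreme φ₁ g₁ hi, g₁.sign_eq_zero_of_extreme hi, add_zero, add_eq_right]
    rcases h.eq_bot_or_eq_top (pullPerm φ₂ g₂ i) with h' | h'
    · exact g₁.sign_eq_zero_of_extreme h'
    · rw [pullPerm_of_extreme φ₂ g₂ ((pullPerm_extreme_iff φ₂ g₂ i).1 h')]
      exact g₁.sign_eq_zero_of_extreme hi
  · rw [pullPerm_of_extreme φ₂ g₂ hi, g₂.sign_eq_zero_of_extreme hi, add_zero, eq_comm,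
      add_eq_right]
    rcases h.eq_bot_or_eq_top (pullPerm φ₁ g₁ i) with h' | h'
    · rw [pullPerm_of_extreme φ₁ g₁ ((pullPerm_extreme_iff φ₁ g₁ i).1 h')]
      exact g₂.sign_eq_zero_of_extreme hi
    · exact g₂.sign_eq_zero_of_extreme h'

end Hyperoct

/-! ### The operadic quotient and its universal property -/

namespace CrossedIntervalGroup

open CrossedGroup

/-- The inert morphisms are fixed by the action of each crossed interval group over `𝔥`. -/
lemma act_of_inert {G : CrossedIntervalGroup.{w}} (p : G ⟶ hyperoctahedral.{w})
    {n k : IntervalCat} {ρ : n ⟶ k} (hρ : IntervalCat.Inert ρ) (x : G.obj k) : G.act x ρ = ρ :=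
  (Hom.act_app p ρ x).symm.trans (Hyperoct.act_of_inert hρ _)

/-- The kernel of $f$ is a crossed subgroup that contains the generating commutators. This serves
both for $P=\mathfrak H$, to form the quotient, and for operadic $P$, to factor through it. -/
lemma operadicKernel_le_ker {G P : CrossedIntervalGroup.{w}} (f : G ⟶ P)
    (hP : ∀ {n k₁ k₂ : IntervalCat} (ρ₁ : n ⟶ k₁) (ρ₂ : n ⟶ k₂),
      IntervalCat.Inert ρ₁ → IntervalCat.Inert ρ₂ → IntervalCat.Dissociated ρ₁ ρ₂ →
        ∀ (x₁ : P.obj k₁) (x₂ : P.obj k₂), Commute (P.map ρ₁ x₁) (P.map ρ₂ x₂))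
    (n : IntervalCat) : G.operadicKernel.carrier n ≤ (Hom.app f n).ker := by
  refine generated_le (ker f) (fun a => ?_) n
  rintro x ⟨k₁, k₂, ρ₁, ρ₂, x₁, x₂, h₁, h₂, h, rfl⟩
  change Hom.app f a _ = 1
  rw [_root_.map_mul, _root_.map_mul, _root_.map_mul, _root_.map_inv, _root_.map_inv,
    Hom.naturality, Hom.naturality, (hP ρ₁ ρ₂ h₁ h₂ h _ _).eq]
  group

lemma operadicKernel_le_ker_hom (G : Over hyperoctahedral.{w}) (n : IntervalCat) :
    G.left.operadicKernel.carrier n ≤ (Hom.app G.hom n).ker :=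
  operadicKernel_le_ker G.hom
    (fun _ _ _ _ h g₁ g₂ => Hyperoct.commute_pull_of_dissociated h g₁ g₂) n

lemma operadicKernel_actsTrivially (G : Over hyperoctahedral.{w}) :
    G.left.operadicKernel.ActsTrivially :=
  fun hx φ => act_of_mem_ker G.hom (operadicKernel_le_ker_hom G _ hx) φ

/-- The degreewise normal closure of `K(G)`. -/
def operadicNormalClosure (G : Over hyperoctahedral.{w}) : G.left.Sub :=
  G.left.operadicKernel.normalClosure (operadicKernel_actsTrivially G)

instance (G : Over hyperoctahedral.{w}) (n : IntervalCat) :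
    ((operadicNormalClosure G).carrier n).Normal :=
  Subgroup.normalClosure_normal

lemma operadicNormalClosure_actsTrivially (G : Over hyperoctahedral.{w}) :
    (operadicNormalClosure G).ActsTrivially :=
  G.left.operadicKernel.normalClosure_actsTrivially _

lemma operadicNormalClosure_le_ker {G : Over hyperoctahedral.{w}} {P : CrossedIntervalGroup.{w}}
    (f : G.left ⟶ P) (hf : ∀ n, G.left.operadicKernel.carrier n ≤ (Hom.app f n).ker)
    (n : IntervalCat) : (operadicNormalClosure G).carrier n ≤ (Hom.app f n).ker :=
  Subgroup.normalClosure_le_normal (hf n)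

/-- The quotient of `G` by the normal closure of `K(G)`, over `𝔥`. -/
def operadicQuotient (G : Over hyperoctahedral.{w}) : Over hyperoctahedral.{w} :=
  Over.mk (quotientLift (operadicNormalClosure G) (operadicNormalClosure_actsTrivially G) G.hom
    (operadicNormalClosure_le_ker G.hom (operadicKernel_le_ker_hom G)))

/-- The projection of `G` onto its quotient by the normal closure of `K(G)`. -/
def operadicQuotientMk (G : Over hyperoctahedral.{w}) : G ⟶ operadicQuotient G :=
  Over.homMk (quotientMk (operadicNormalClosure G) (operadicNormalClosure_actsTrivially G))
    (quotientMk_lift _ _ _ _)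

lemma operadicQuotientMk_surjective (G : Over hyperoctahedral.{w}) (n : IntervalCat) :
    Function.Surjective (Hom.app (operadicQuotientMk G).left n) :=
  quotientMk_surjective _ (operadicNormalClosure_actsTrivially G) n

lemma ker_operadicQuotientMk (G : Over hyperoctahedral.{w}) (n : IntervalCat) :
    (Hom.app (operadicQuotientMk G).left n).ker =
      Subgroup.normalClosure (G.left.operadicKernel.carrier n : Set (G.left.obj n)) :=
  ker_quotientMk _ (operadicNormalClosure_actsTrivially G) n

/-- Inert morphisms are fixed over $\mathfrak H$ in any case; for the commutation, lift both
elements to $G$, where the commutator of their restrictions is a generator of $K(G)$. -/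
lemma isOperadic_operadicQuotient (G : Over hyperoctahedral.{w}) :
    isOperadicOver (operadicQuotient G) := by
  refine ⟨fun ρ hρ x => act_of_inert (operadicQuotient G).hom hρ x, ?_⟩
  intro n k₁ k₂ ρ₁ ρ₂ h₁ h₂ h x₁ x₂
  obtain ⟨y₁, rfl⟩ := operadicQuotientMk_surjective G k₁ x₁
  obtain ⟨y₂, rfl⟩ := operadicQuotientMk_surjective G k₂ x₂
  rw [← Hom.naturality, ← Hom.naturality, ← commutatorElement_eq_one_iff_commute,
    commutatorElement_def, ← _root_.map_inv, ← _root_.map_inv, ← _root_.map_mul,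
    ← _root_.map_mul, ← _root_.map_mul, ← MonoidHom.mem_ker, ker_operadicQuotientMk]
  exact Subgroup.subset_normalClosure
    (subset_generated _ n ⟨k₁, k₂, ρ₁, ρ₂, y₁, y₂, h₁, h₂, h, rfl⟩)

/-- Maps over `𝔥` that are trivial on `K(G)` factor through the quotient. -/
def operadicQuotientLift {G P : Over hyperoctahedral.{w}} (f : G ⟶ P)
    (hf : ∀ n, G.left.operadicKernel.carrier n ≤ (Hom.app f.left n).ker) :
    operadicQuotient G ⟶ P :=
  Over.homMk (quotientLift (operadicNormalClosure G) (operadicNormalClosure_actsTrivially G) f.left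
      (operadicNormalClosure_le_ker f.left hf))
    (hom_ext fun n x => by
      obtain ⟨y, rfl⟩ := operadicQuotientMk_surjective G n x
      exact congrArg (fun k : G.left ⟶ hyperoctahedral => Hom.app k n y) (Over.w f))

lemma operadicQuotientMk_lift {G P : Over hyperoctahedral.{w}} (f : G ⟶ P)
    (hf : ∀ n, G.left.operadicKernel.carrier n ≤ (Hom.app f.left n).ker) :
    operadicQuotientMk G ≫ operadicQuotientLift f hf = f :=
  Over.OverMorphism.ext (hom_ext fun _ _ => rfl)

lemma operadicQuotient_hom_ext {G P : Over hyperoctahedral.{w}} {f g : operadicQuotient G ⟶ P}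
    (h : operadicQuotientMk G ≫ f = operadicQuotientMk G ≫ g) : f = g :=
  Over.OverMorphism.ext (quotient_hom_ext _ (operadicNormalClosure_actsTrivially G)
    (congrArg CommaMorphism.left h))

lemma operadicKernel_le_ker_of_isOperadicOver {G P : Over hyperoctahedral.{w}} (f : G ⟶ P)
    (hP : isOperadicOver P) (n : IntervalCat) :
    G.left.operadicKernel.carrier n ≤ (Hom.app f.left n).ker :=
  operadicKernel_le_ker f.left hP.2 n

/-- The universal property of the quotient, with respect to operadic objects. -/
def operadicQuotientHomEquiv (G : Over hyperoctahedral.{w}) (P : CrsOpGrp.{w}) :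
    ((⟨operadicQuotient G, isOperadic_operadicQuotient G⟩ : CrsOpGrp.{w}) ⟶ P) ≃
      (G ⟶ isOperadicOver.ι.obj P) where
  toFun f := operadicQuotientMk G ≫ f.hom
  invFun f := ObjectProperty.homMk
    (operadicQuotientLift f (operadicKernel_le_ker_of_isOperadicOver f P.property))
  left_inv f := ObjectProperty.hom_ext _ (operadicQuotient_hom_ext
    (operadicQuotientMk_lift _ (operadicKernel_le_ker_of_isOperadicOver
      (operadicQuotientMk G ≫ f.hom) P.property)))
  right_inv f := operadicQuotientMk_lift _
    (operadicKernel_le_ker_of_isOperadicOver f P.property)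

lemma operadicQuotientHomEquiv_comp (G : Over hyperoctahedral.{w}) (P Q : CrsOpGrp.{w})
    (g : P ⟶ Q)
    (f : (⟨operadicQuotient G, isOperadic_operadicQuotient G⟩ : CrsOpGrp.{w}) ⟶ P) :
    operadicQuotientHomEquiv G Q (f ≫ g) =
      operadicQuotientHomEquiv G P f ≫ isOperadicOver.ι.map g :=
  (Category.assoc (operadicQuotientMk G) f.hom g.hom).symm

/-- The quotients by the normal closures of the `K(G)` form a reflection on the operadic objects. -/
abbrev operadicReflective :
    Reflective (isOperadicOver.{w}.ι : CrsOpGrp.{w} ⥤ Over hyperoctahedral.{w}) where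
  L := Adjunction.leftAdjointOfEquiv operadicQuotientHomEquiv operadicQuotientHomEquiv_comp
  adj := Adjunction.adjunctionOfEquivLeft operadicQuotientHomEquiv operadicQuotientHomEquiv_comp

/-- The unit corresponds to the identity of the quotient under the bijection of morphism sets, which
is precomposition with the projection. -/
lemma operadicReflective_unit_app (G : Over hyperoctahedral.{w}) :
    operadicReflective.adj.unit.app G = operadicQuotientMk G :=
  (Adjunction.adjunctionOfEquivLeft_unit_app operadicQuotientHomEquiv
    operadicQuotientHomEquiv_comp G).trans (Category.comp_id (operadicQuotientMk G))

/-- The map `K(G) ⟶ *` over `𝔥`. -/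
def operadicKernelToTrivial (G : Over hyperoctahedral.{w}) : operadicKernelOver G ⟶ trivialOver :=
  Over.homMk
    { app := fun _ => 1
      naturality := fun _ _ => rfl
      act_app := fun φ x => (operadicKernel_actsTrivially G x.2 φ).symm }
    (hom_ext fun n x => (operadicKernel_le_ker_hom G n x.2).symm)

/-- The leg out of $*$ is unique, so a cocone is just a map from $G$ that is trivial on $K(G)$. -/
lemma isPushout_operadicQuotientMk (G : Over hyperoctahedral.{w}) :
    IsPushout (operadicKernelIncl G) (operadicKernelToTrivial G) (operadicQuotientMk G)
      (fromTrivialOver (operadicQuotient G)) := by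
  refine ⟨⟨?_⟩, ⟨Limits.PushoutCocone.IsColimit.mk _
    (fun s => operadicQuotientLift s.inl fun n x hx => ?_) (fun s => operadicQuotientMk_lift _ _)
    (fun s => Over.OverMorphism.ext (trivial_hom_ext _ _))
    (fun s f h₁ _ => operadicQuotient_hom_ext
      (h₁.trans (operadicQuotientMk_lift _ _).symm))⟩⟩
  · refine Over.OverMorphism.ext (hom_ext fun n x => ?_)
    have hx : x.1 ∈ (Hom.app (operadicQuotientMk G).left n).ker := by
      rw [ker_operadicQuotientMk]
      exact Subgroup.subset_normalClosure x.2
    exact hx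
  -- Evaluated at $x\in K(G)_n$, the cocone condition says that the image of $x$ comes from $*$, so
  -- it is $1$.
  · have h := congrArg
      (fun f : operadicKernelOver G ⟶ s.pt => Hom.app (CommaMorphism.left f) n
        (⟨x, hx⟩ : G.left.operadicKernel.carrier n)) s.condition
    exact h.trans (_root_.map_one (Hom.app s.inr.left n))

end CrossedIntervalGroup

theorem mainTheorem3 :
    ∃ R : Reflective (isOperadicOver.{w}.ι : CrsOpGrp.{w} ⥤ Over hyperoctahedral.{w}),
      ∀ G : Over hyperoctahedral.{w},
        (∃ t : operadicKernelOver G ⟶ trivialOver,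
          IsPushout (operadicKernelIncl G) t (R.adj.unit.app G)
            (fromTrivialOver ((isOperadicOver.ι).obj (R.L.obj G)))) ∧
        ∀ n : IntervalCat,
          Function.Surjective ((R.adj.unit.app G).left.app n) ∧
          ((R.adj.unit.app G).left.app n).ker =
            Subgroup.normalClosure (G.left.operadicKernel.carrier n : Set (G.left.obj n)) := by
  refine ⟨CrossedIntervalGroup.operadicReflective, fun G => ?_⟩
  rw [CrossedIntervalGroup.operadicReflective_unit_app]
  exact ⟨⟨_, CrossedIntervalGroup.isPushout_operadicQuotientMk G⟩, fun n =>
    ⟨CrossedIntervalGroup.operadicQuotientMk_surjective G n,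
      CrossedIntervalGroup.ker_operadicQuotientMk G n⟩⟩
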